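/- Let $G$ be a finite simple connected graph on the vertex set $V$ ($n=|V|$), with $m$ edges, in which every vertex has degree at least $2$ and which is not a cycle (i.e. not $2$-regular). Let $\{\tilde X_k\}_{k\ge 0}$ be the non-backtracking random walk on $V$: from $\tilde X_0=i$ the first step goes to a uniformly random neighbour of $i$, and each later step goes from the current vertex to a uniformly random neighbour other than the vertex visited immediately before. Put $\tilde T_j=\min\{k\ge 0:\tilde X_k=j\}$ and $\tilde T_i^+=\min\{k\ge 1:\tilde X_k=i\}$. Let $M_v^{(nb)}=(m_{ij})$ be the $n\times n$ matrix with $m_{ij}=\mathbb E[\tilde T_j\mid \tilde X_0=i]$ for $i\ne j$ and $m_{ii}=0$, and let $R$ be the diagonal matrix with entries $r_i=\mathbb E[\tilde T_i^+\mid \tilde X_0=i]$. Let $P_{nb}$ be the $2m\times 2m$ transition matrix of the walk on directed edges, $P_{nb}((i,j),(k,\ell))=\frac1{\deg(j)-1}$ if $j=k$ and $\ell\neq i$, and $0$ otherwise. Let $\pi_j=\deg(j)/2m$, $\pi_e=\frac1{2m}\mathbb 1$, $W_v=\mathbb 1\pi^{\top}$, $W_e=\mathbb 1\pi_e^{\top}$,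 and $Z_e^{(nb)}=(I-P_{nb}+W_e)^{-1}$. Let $D$ be the diagonal matrix of degrees, let $S$ be the $2m\times n$ matrix with $S((i,j),x)=1$ if $j=x$ and $0$ otherwise, and let $T$ be the $n\times 2m$ matrix with $T(x,(i,j))=1$ if $i=x$ and $0$ otherwise. Define $$Z^{(nb)}=(z_{ij})=I+D^{-1}TZ_e^{(nb)}S-W_v .$$ Suppose that $G$ has locally uniform return times: for every vertex $i$, $\mathbb E[\tilde T_i^+\mid \tilde X_0=i,\tilde X_1=j]$ is the same for all neighbours $j$ of $i$. Then all the quantities above are well defined (the expectations $\mathbb E[\tilde T_j\mid \tilde X_0=i]$ and $r_i$ are finite, and $I-P_{nb}+W_e$ is invertible), $Z^{(nb)}=D^{-1}TZ_e^{(nb)}T^{\top}$, and, with $J$ the all-ones matrix, $$M_v^{(nb)}=J-Z^{(nb)}R+W_vM_v^{(nb)} .$$ In particular, for all $i,j\in V$, $$m_{ij}=\frac{z_{jj}-z_{ij}}{\pi_j}.$$ -/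

import Mathlib

open MeasureTheory ProbabilityTheory
open scoped ENNReal

namespace NBWalk

noncomputable section

variable {V : Type*} [Fintype V] [DecidableEq V]

/-! ### The non-backtracking random walk on the vertices -/

section Walk

variable (G : SimpleGraph V) [DecidableRel G.Adj]

/-- The vertices to which a non-backtracking walker with history `h 0, …, h n` may move: all
neighbours of `h 0` at the first step, and the neighbours of the current vertex other than the
previously visited one afterwards. -/
def choices : (n : ℕ) → (Finset.Iic n → V) → Finset V
  | 0, h => G.neighborFinset (h ⟨0, Finset.mem_Iic.2 le_rfl⟩)
  | n + 1, h =>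
      (G.neighborFinset (h ⟨n + 1, Finset.mem_Iic.2 le_rfl⟩)).erase
        (h ⟨n, Finset.mem_Iic.2 (Nat.le_succ n)⟩)

/-- The law of the next vertex: uniform on the admissible vertices.  (If no vertex is admissible,
which cannot happen when all degrees are at least two, the walker stays where it is.) -/
def stepPMF (n : ℕ) (h : Finset.Iic n → V) : PMF V :=
  if hne : (choices G n h).Nonempty then PMF.uniformOfFinset (choices G n h) hne
  else PMF.pure (h ⟨n, Finset.mem_Iic.2 le_rfl⟩)

variable [MeasurableSpace V] [DiscreteMeasurableSpace V]

/-- The transition kernels of the walk, given the whole history up to time `n`. -/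
def stepKernel (n : ℕ) : Kernel (Finset.Iic n → V) V :=
  Kernel.ofFunOfCountable fun h => (stepPMF G n h).toMeasure

instance isMarkovKernel_stepKernel (n : ℕ) : IsMarkovKernel (stepKernel G n) :=
  ⟨fun h => PMF.toMeasure.isProbabilityMeasure (stepPMF G n h)⟩

/-- The law, on the space of trajectories `X : ℕ → V`, of the non-backtracking random walk started
at the vertex `i`. -/
def law (i : V) : Measure (ℕ → V) :=
  Kernel.traj (X := fun _ => V) (stepKernel G) 0 fun _ => i

/-- The first time `k ≥ 0` with `X k = j` (`∞` if there is none). -/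
def hittingTime (j : V) (X : ℕ → V) : ℝ≥0∞ := ⨅ (k : ℕ) (_ : X k = j), (k : ℝ≥0∞)

/-- The first time `k ≥ 1` with `X k = i` (`∞` if there is none). -/
def returnTime (i : V) (X : ℕ → V) : ℝ≥0∞ := ⨅ (k : ℕ) (_ : 1 ≤ k ∧ X k = i), (k : ℝ≥0∞)

/-- `E[T_j | X_0 = i]`. -/
def meanHitting (i j : V) : ℝ≥0∞ := ∫⁻ X, hittingTime j X ∂(law G i)

/-- `E[T_i^+ | X_0 = i]`. -/
def meanReturn (i : V) : ℝ≥0∞ := ∫⁻ X, returnTime i X ∂(law G i)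

/-- `E[T_i^+ | X_0 = i, X_1 = j]`. -/
def meanReturnVia (i j : V) : ℝ≥0∞ :=
  ∫⁻ X, returnTime i X ∂(cond (law G i) {X | X 1 = j})

/-- The non-backtracking random walk on `G` has locally uniform return time: the mean return time
to a vertex `i` does not depend on the first step. -/
def LocallyUniformReturnTime : Prop :=
  ∀ i j j' : V, G.Adj i j → G.Adj i j' → meanReturnVia G i j = meanReturnVia G i j'

/-- The matrix `M_v` of non-backtracking first hitting times. -/
def hittingMatrix : Matrix V V ℝ :=
  Matrix.of fun i j => if j = i then 0 else (meanHitting G i j).toReal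

/-- The diagonal matrix `R` of non-backtracking mean return times. -/
def returnMatrix : Matrix V V ℝ := Matrix.diagonal fun i => (meanReturn G i).toReal

end Walk

/-! ### Stationary distributions and fundamental matrices -/

section Matrices

variable (G : SimpleGraph V) [DecidableRel G.Adj]

/-- The stationary distribution `π_j = deg j / (2 m)` on the vertices. -/
def statV (j : V) : ℝ := (G.degree j : ℝ) / (2 * (G.edgeFinset.card : ℝ))

/-- The stationary distribution `π_e = 1 / (2 m)` on the directed edges. -/
def statE (_e : G.Dart) : ℝ := 1 / (2 * (G.edgeFinset.card : ℝ))

/-- `W_v = 𝟙 πᵀ`. -/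
def Wv : Matrix V V ℝ := Matrix.vecMulVec (fun _ => 1) (statV G)

/-- `W_e = 𝟙 π_eᵀ`. -/
def We : Matrix G.Dart G.Dart ℝ := Matrix.vecMulVec (fun _ => 1) (statE G)

/-- The transition matrix of the non-backtracking random walk on the directed edges. -/
def Pnb : Matrix G.Dart G.Dart ℝ :=
  Matrix.of fun e f =>
    if e.snd = f.fst ∧ f.snd ≠ e.fst then 1 / ((G.degree e.snd : ℝ) - 1) else 0

/-- The lifting matrix `S`, with `S (i, j) x = 1` if `j = x`. -/
def S : Matrix G.Dart V ℝ := Matrix.of fun e x => if e.snd = x then 1 else 0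

/-- The projecting matrix `T`, with `T x (i, j) = 1` if `i = x`. -/
def T : Matrix V G.Dart ℝ := Matrix.of fun x e => if e.fst = x then 1 else 0

/-- The inverse `D⁻¹` of the diagonal matrix of degrees. -/
def Dinv : Matrix V V ℝ := Matrix.diagonal fun v => ((G.degree v : ℝ))⁻¹

/-- The fundamental matrix `Z_e = (I - P_nb + W_e)⁻¹` of the walk on the directed edges. -/
def Ze : Matrix G.Dart G.Dart ℝ := (1 - Pnb G + We G)⁻¹

/-- The vertex-space fundamental matrix `Z = I + D⁻¹ T Z_e S - W_v`. -/
def Zv : Matrix V V ℝ := 1 + Dinv G * T G * Ze G * S G - Wv G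

end Matrices

end

end NBWalk

/-! Fix a target `j`. For a directed edge `e` just traversed, let `H e` be the mean time still
needed to reach `j`, with `H e = 0` if `e` ends at `j`. Away from the edges into `j`, conditioning
on the next step gives `H = 1 + P H`. On an edge into `j`, `P H` averages `H` over all out-edges of
`j` but one. Locally uniform return times make `H` equal to `r_j - 1` on each of them, so the single
equation `H = 1 - r_j S_j + P H` holds on every edge (`toReal_meanHittingDart_eq`).

`P` is doubly stochastic, so summing the equation gives `r_j π_j = 1`, and applying `Z_e` gives `H =
const - r_j Z_e S_j`. Averaging over the out-edges of `i` turns this into `m_ij = c_j - z_ij r_j`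
(`exists_const_sub_Zv`). The diagonal entry `m_jj = 0`, and averaging over `i` with weights `π_i`,
eliminate `c_j` and yield the two formulas.

Invertibility of `I - P + W_e` holds because only constants are fixed by `P`. Finiteness follows by
comparing the probabilistic series for `H`, the least nonnegative solution, with a finite solution
built from `Z_e`. -/

namespace NBWalk

/-! ### Hitting and return times along one trajectory -/

section Paths

variable {V : Type*}

theorem hittingTime_eq_returnTime {j : V} {X : ℕ → V} (h : X 0 ≠ j) :
    hittingTime j X = returnTime j X := by
  unfold hittingTime returnTime
  refine iInf_congr fun k => ?_
  have : X k = j ↔ 1 ≤ k ∧ X k = j :=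
    ⟨fun hk => ⟨Nat.one_le_iff_ne_zero.2 fun h0 => h (h0 ▸ hk), hk⟩, fun hk => hk.2⟩
  exact iInf_congr_Prop this fun _ => rfl

theorem hittingTime_eq_zero {j : V} {X : ℕ → V} (h : X 0 = j) : hittingTime j X = 0 :=
  le_antisymm ((iInf₂_le 0 h).trans (by simp)) bot_le

variable [DecidableEq V]

/-- The indicator of the event that the times `1, …, n` do not visit `j`. -/
noncomputable def avoid (j : V) (n : ℕ) (X : ℕ → V) : ℝ≥0∞ :=
  ∏ k ∈ Finset.range n, if X (k + 1) = j then 0 else 1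

theorem avoid_succ (j : V) (n : ℕ) (X : ℕ → V) :
    avoid j (n + 1) X = avoid j n X * if X (n + 1) = j then 0 else 1 :=
  Finset.prod_range_succ _ _

/-- This is the tail sum `T = ∑ 1{T > n}`, since `avoid j n` indicates that the return time exceeds
`n`. If `j` is never visited, both sides are infinite. -/
theorem returnTime_eq_tsum_avoid (j : V) (X : ℕ → V) :
    returnTime j X = ∑' n, avoid j n X := by
  classical
  by_cases h : ∃ k, 1 ≤ k ∧ X k = j
  · have h0 := Nat.find_spec h
    have hlt : ∀ k, k < Nat.find h → ¬ (1 ≤ k ∧ X k = j) := fun k => Nat.find_min h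
    set N := Nat.find h
    have h1 : returnTime j X = N := by
      refine le_antisymm (iInf₂_le N h0) (le_iInf₂ fun k hk => ?_)
      exact_mod_cast not_lt.1 fun hlt' => hlt k hlt' hk
    have h2 : ∀ n, avoid j n X = if n < N then 1 else 0 := by
      intro n
      split_ifs with hn
      · refine Finset.prod_eq_one fun k hk => if_neg fun hX => ?_
        rw [Finset.mem_range] at hk
        exact hlt (k + 1) (by omega) ⟨by omega, hX⟩
      · refine Finset.prod_eq_zero (i := N - 1) (by rw [Finset.mem_range]; omega) (if_pos ?_)
        rw [Nat.sub_add_cancel h0.1]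
        exact h0.2
    simp_rw [h1, h2]
    rw [tsum_eq_sum (s := Finset.range N) (by simp)]
    rw [Finset.sum_congr rfl fun n hn => if_pos (Finset.mem_range.1 hn)]
    simp
  · push Not at h
    have h2 : ∀ n, avoid j n X = 1 := fun n =>
      Finset.prod_eq_one fun k _ => if_neg (h (k + 1) (by omega))
    have h1 : returnTime j X = ∞ := by
      simp only [returnTime, iInf_eq_top]
      exact fun k hk => absurd hk.2 (h k hk.1)
    simp [h1, h2]

end Paths

/-! ### Mean hitting times of the edge walk as a series of killed steps -/

section KilledStep

variable {V : Type*} [Fintype V] [DecidableEq V] (G : SimpleGraph V) [DecidableRel G.Adj]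

/-- One step of the walk on directed edges, killed on arrival at `j`. -/
noncomputable def killedStep (j : V) (g : V → V → ℝ≥0∞) (a b : V) : ℝ≥0∞ :=
  ∑ c ∈ (G.neighborFinset b).erase a,
    (((G.neighborFinset b).erase a).card : ℝ≥0∞)⁻¹ * if c = j then 0 else g b c

/-- The mean time to reach `j` for the walk that has just made the step from `a` to `b`. -/
noncomputable def meanHittingDart (j a b : V) : ℝ≥0∞ :=
  if b = j then 0 else ∑' n, (killedStep G j)^[n] (fun _ _ => 1) a b

/-- The term `n = 0` of the series gives the 1; one killed step applied to the whole series gives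
the rest. The value 0 at `j` agrees with killing on arrival. -/
theorem meanHittingDart_of_ne {j b : V} (a : V) (h : b ≠ j) :
    meanHittingDart G j a b = 1 + ∑ c ∈ (G.neighborFinset b).erase a,
      (((G.neighborFinset b).erase a).card : ℝ≥0∞)⁻¹ * meanHittingDart G j b c := by
  rw [meanHittingDart, if_neg h, tsum_eq_zero_add' ENNReal.summable]
  congr 1
  simp_rw [Function.iterate_succ_apply']
  unfold killedStep
  rw [Summable.tsum_finsetSum fun _ _ => ENNReal.summable]
  refine Finset.sum_congr rfl fun c _ => ?_
  rw [ENNReal.tsum_mul_left]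
  congr 1
  unfold meanHittingDart
  split_ifs
  · simp
  · rfl

variable {G}

theorem card_erase_neighborFinset_pos (hdeg : ∀ v, 2 ≤ G.degree v) (a b : V) :
    0 < ((G.neighborFinset b).erase a).card := by
  have := Finset.pred_card_le_card_erase (s := G.neighborFinset b) (a := a)
  have := hdeg b
  rw [← G.card_neighborFinset_eq_degree] at this
  omega

end KilledStep

/-! ### Expectations under the law of the walk -/

section Probability

variable {V : Type*} [Fintype V] [DecidableEq V] [MeasurableSpace V] [DiscreteMeasurableSpace V]
  (G : SimpleGraph V) [DecidableRel G.Adj]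

instance isProbabilityMeasure_law (i : V) : IsProbabilityMeasure (law G i) := by
  unfold law; infer_instance

/-- One-step Markov property: the next position may be averaged out given the history. -/
theorem lintegral_law_succ (i : V) (n : ℕ) (g : (Finset.Iic n → V) → V → ℝ≥0∞) :
    ∫⁻ X, g (Preorder.frestrictLe n X) (X (n + 1)) ∂(law G i) =
      ∫⁻ X, ∑ c, g (Preorder.frestrictLe n X) c * stepPMF G n (Preorder.frestrictLe n X) c
        ∂(law G i) := by
  -- A functional of the history up to `m` depends only on the finite-time marginal, which satisfies
  -- a one-step recursion.
  have hL : ∀ (m : ℕ) (F : (Finset.Iic m → V) → ℝ≥0∞),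
      ∫⁻ X, F (Preorder.frestrictLe m X) ∂(law G i) =
        ∫⁻ x, F x ∂(Kernel.partialTraj (X := fun _ => V) (stepKernel G) 0 m fun _ => i) := by
    intro m F
    rw [← Kernel.traj_map_frestrictLe_apply, lintegral_map (.of_discrete) (by fun_prop)]
    rfl
  rw [hL n fun x => ∑ c, g x c * stepPMF G n x c]
  have h1 := hL (n + 1) fun x => g (Preorder.frestrictLe₂ (π := fun _ => V) (Nat.le_succ n) x)
    (x ⟨n + 1, Finset.mem_Iic.2 le_rfl⟩)
  refine Eq.trans h1 ?_
  rw [Kernel.partialTraj_succ_of_le (Nat.zero_le n),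
    Kernel.lintegral_map _ (by fun_prop) _ .of_discrete,
    Kernel.lintegral_comp _ _ _ .of_discrete]
  refine lintegral_congr fun x => ?_
  rw [Kernel.lintegral_id_prod .of_discrete, Kernel.lintegral_map _ (by fun_prop) _ .of_discrete,
    lintegral_fintype]
  refine Finset.sum_congr rfl fun c _ => ?_
  congr 1
  · congr 1
    · ext k
      simp [IicProdIoc, Finset.mem_Iic.1 k.2]
    · simp [IicProdIoc, MeasurableEquiv.piSingleton]
  · exact PMF.toMeasure_apply_singleton _ _ (measurableSet_singleton _)

theorem law_zero (i : V) : ∀ᵐ X ∂(law G i), X 0 = i := by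
  have h := Kernel.traj_map_frestrictLe_apply (X := fun _ => V) (κ := stepKernel G) 0 0 (fun _ => i)
  rw [Kernel.partialTraj_self, Kernel.id_apply] at h
  have : ∀ᵐ x ∂((law G i).map (Preorder.frestrictLe 0)),
      x ⟨0, Finset.mem_Iic.2 le_rfl⟩ = i := by
    unfold law
    rw [h, ae_dirac_iff .of_discrete]
  exact ae_of_ae_map (by fun_prop) this

theorem measurable_avoid (j : V) (n : ℕ) : Measurable (avoid j n) := by
  unfold avoid
  refine Finset.measurable_prod _ fun k _ => ?_
  exact (Measurable.of_discrete (f := fun v : V => if v = j then (0 : ℝ≥0∞) else 1)).comp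
    (measurable_pi_apply (k + 1))

variable {G}

theorem sum_mul_stepPMF_succ (hdeg : ∀ v, 2 ≤ G.degree v) (n : ℕ) (h : Finset.Iic (n + 1) → V)
    (F : V → ℝ≥0∞) :
    ∑ c, F c * stepPMF G (n + 1) h c =
      ∑ c ∈ choices G (n + 1) h, ((choices G (n + 1) h).card : ℝ≥0∞)⁻¹ * F c := by
  have hne : (choices G (n + 1) h).Nonempty :=
    Finset.card_pos.1 (card_erase_neighborFinset_pos hdeg _ _)
  rw [stepPMF, dif_pos hne]
  simp only [PMF.uniformOfFinset_apply, mul_ite, mul_zero]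
  rw [← Finset.sum_filter]
  simp [mul_comm]

theorem sum_mul_stepPMF_zero (hdeg : ∀ v, 2 ≤ G.degree v) {h : Finset.Iic 0 → V} {i : V}
    (hi : h ⟨0, Finset.mem_Iic.2 le_rfl⟩ = i) (F : V → ℝ≥0∞) :
    ∑ c, F c * stepPMF G 0 h c = ∑ c ∈ G.neighborFinset i, (G.degree i : ℝ≥0∞)⁻¹ * F c := by
  subst hi
  have hne : (choices G 0 h).Nonempty := by
    have := hdeg (h ⟨0, Finset.mem_Iic.2 le_rfl⟩)
    rw [← G.card_neighborFinset_eq_degree] at this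
    exact Finset.card_pos.1 (lt_of_lt_of_le two_pos this)
  rw [stepPMF, dif_pos hne]
  simp only [PMF.uniformOfFinset_apply, mul_ite, mul_zero]
  rw [← Finset.sum_filter, Finset.filter_mem_eq_inter, Finset.univ_inter]
  refine Finset.sum_congr rfl fun c _ => ?_
  rw [mul_comm, ← G.card_neighborFinset_eq_degree]
  rfl

theorem lintegral_law_first_step (hdeg : ∀ v, 2 ≤ G.degree v) (i : V) (F : V → V → ℝ≥0∞) :
    ∫⁻ X, F (X 0) (X 1) ∂(law G i) =
      ∑ b ∈ G.neighborFinset i, (G.degree i : ℝ≥0∞)⁻¹ * F i b := by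
  refine (lintegral_law_succ G i 0 fun x c => F (x ⟨0, Finset.mem_Iic.2 le_rfl⟩) c).trans ?_
  trans ∫⁻ _, ∑ b ∈ G.neighborFinset i, (G.degree i : ℝ≥0∞)⁻¹ * F i b ∂(law G i)
  · refine lintegral_congr_ae ?_
    filter_upwards [law_zero G i] with X hX
    rw [sum_mul_stepPMF_zero hdeg (i := i) hX]
    simp only [Preorder.frestrictLe_apply, hX]
  · simp

/-- Averaging out the last step replaces `g` by `killedStep G j g`, the last factor of `avoid` doing
the killing; hence the induction must allow every `g`. The weight `φ (X 1)` is carried along so that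
the first step can later be conditioned on. -/
theorem lintegral_avoid_mul (hdeg : ∀ v, 2 ≤ G.degree v) (i j : V) (φ : V → ℝ≥0∞) (n : ℕ)
    (g : V → V → ℝ≥0∞) :
    ∫⁻ X, φ (X 1) * avoid j (n + 1) X * g (X n) (X (n + 1)) ∂(law G i) =
      ∑ b ∈ G.neighborFinset i, (G.degree i : ℝ≥0∞)⁻¹ *
        (φ b * if b = j then 0 else (killedStep G j)^[n] g i b) := by
  induction n generalizing g with
  | zero =>
    simp only [avoid, zero_add, Finset.prod_range_one, Function.iterate_zero, id]
    rw [lintegral_law_first_step hdeg i fun a b => φ b * (if b = j then 0 else 1) * g a b]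
    refine Finset.sum_congr rfl fun b _ => ?_
    split_ifs <;> simp
  | succ n ih =>
    rw [Function.iterate_succ_apply, ← ih]
    have h := lintegral_law_succ G i (n + 1) fun x c =>
      (φ (x ⟨1, Finset.mem_Iic.2 (by omega)⟩) * ∏ k : Fin (n + 1),
        if x ⟨k + 1, Finset.mem_Iic.2 (by omega)⟩ = j then 0 else 1) *
        (if c = j then 0 else g (x ⟨n + 1, Finset.mem_Iic.2 le_rfl⟩) c)
    simp only [sum_mul_stepPMF_succ hdeg, Preorder.frestrictLe_apply] at h
    have key : ∀ X : ℕ → V, avoid j (n + 1) X =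
        ∏ k : Fin (n + 1), if X (k + 1) = j then 0 else 1 := fun X =>
      Finset.prod_range fun k => if X (k + 1) = j then 0 else 1
    trans ∫⁻ X, φ (X 1) * avoid j (n + 1) X *
      (if X (n + 1 + 1) = j then 0 else g (X (n + 1)) (X (n + 1 + 1))) ∂(law G i)
    · refine lintegral_congr fun X => ?_
      rw [avoid_succ]
      split_ifs <;> simp
    simp_rw [key]
    refine Eq.trans h ?_
    refine lintegral_congr fun X => ?_
    unfold killedStep
    rw [Finset.mul_sum]
    exact Finset.sum_congr rfl fun c _ => mul_left_comm _ _ _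

theorem lintegral_mul_returnTime (hdeg : ∀ v, 2 ≤ G.degree v) (i j : V) (φ : V → ℝ≥0∞) :
    ∫⁻ X, φ (X 1) * returnTime j X ∂(law G i) =
      ∑ b ∈ G.neighborFinset i, (G.degree i : ℝ≥0∞)⁻¹ *
        (φ b * (1 + meanHittingDart G j i b)) := by
  have hφ : Measurable fun X : ℕ → V => φ (X 1) :=
    (Measurable.of_discrete (f := φ)).comp (measurable_pi_apply 1)
  simp_rw [returnTime_eq_tsum_avoid, ← ENNReal.tsum_mul_left]
  rw [lintegral_tsum fun n => (hφ.fun_mul (measurable_avoid j n)).aemeasurable,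
    tsum_eq_zero_add' ENNReal.summable]
  have h1 := fun n => lintegral_avoid_mul hdeg i j φ n fun _ _ => 1
  simp only [mul_one] at h1
  simp_rw [h1]
  rw [Summable.tsum_finsetSum fun _ _ => ENNReal.summable]
  simp only [avoid, Finset.range_zero, Finset.prod_empty, mul_one]
  rw [lintegral_law_first_step hdeg i fun _ b => φ b, ← Finset.sum_add_distrib]
  refine Finset.sum_congr rfl fun b _ => ?_
  rw [ENNReal.tsum_mul_left, ENNReal.tsum_mul_left, ← mul_add, mul_add (φ b), mul_one]
  congr 3
  unfold meanHittingDart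
  split_ifs <;> simp

theorem meanReturn_eq (hdeg : ∀ v, 2 ≤ G.degree v) (i : V) :
    meanReturn G i =
      ∑ b ∈ G.neighborFinset i, (G.degree i : ℝ≥0∞)⁻¹ * (1 + meanHittingDart G i i b) := by
  simpa [meanReturn] using lintegral_mul_returnTime hdeg i i fun _ => 1

theorem meanHitting_self (i : V) : meanHitting G i i = 0 := by
  rw [meanHitting, lintegral_congr_ae (g := fun _ => 0), lintegral_zero]
  filter_upwards [law_zero G i] with X hX using hittingTime_eq_zero hX

theorem meanHitting_eq (hdeg : ∀ v, 2 ≤ G.degree v) {i j : V} (hij : i ≠ j) :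
    meanHitting G i j =
      ∑ b ∈ G.neighborFinset i, (G.degree i : ℝ≥0∞)⁻¹ * (1 + meanHittingDart G j i b) := by
  have h : meanHitting G i j = ∫⁻ X, returnTime j X ∂(law G i) := by
    refine lintegral_congr_ae ?_
    filter_upwards [law_zero G i] with X hX using hittingTime_eq_returnTime (hX.trans_ne hij)
  simpa [h] using lintegral_mul_returnTime hdeg i j fun _ => 1

/-- With `φ` the indicator of `k`, the restricted integral and the probability of the event both
carry the factor `1 / deg i`, which cancels on conditioning. -/
theorem meanReturnVia_eq (hdeg : ∀ v, 2 ≤ G.degree v) {i k : V} (hik : G.Adj i k) :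
    meanReturnVia G i k = 1 + meanHittingDart G i i k := by
  have hm : MeasurableSet {X : ℕ → V | X 1 = k} :=
    measurableSet_eq_fun (measurable_pi_apply 1) measurable_const
  have hd : (G.degree i : ℝ≥0∞) ≠ 0 := by
    have := hdeg i
    exact_mod_cast (by omega : G.degree i ≠ 0)
  have h1 := lintegral_law_first_step hdeg i fun _ b => if b = k then 1 else 0
  have h2 := lintegral_mul_returnTime hdeg i i fun b => if b = k then 1 else 0
  have e1 : ∫⁻ X, (if X 1 = k then 1 else 0) ∂(law G i) = law G i {X | X 1 = k} := by
    rw [← lintegral_indicator_one hm]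
    exact lintegral_congr fun X => by simp [Set.indicator_apply]
  have e2 : ∫⁻ X, (if X 1 = k then 1 else 0) * returnTime i X ∂(law G i) =
      ∫⁻ X in {X | X 1 = k}, returnTime i X ∂(law G i) := by
    rw [← lintegral_indicator hm]
    exact lintegral_congr fun X => by simp [Set.indicator_apply]
  rw [e1] at h1
  rw [e2] at h2
  simp [hik] at h1 h2
  rw [meanReturnVia, ProbabilityTheory.cond, lintegral_smul_measure, h1, h2, smul_eq_mul, inv_inv, ← mul_assoc,
    ENNReal.mul_inv_cancel hd (by simp), one_mul]

end Probability

/-! ### Degrees and sums over directed edges -/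

section Degrees

variable {V : Type*} [Fintype V] {G : SimpleGraph V} [DecidableRel G.Adj]

theorem degree_sub_one_pos (hdeg : ∀ v, 2 ≤ G.degree v) (v : V) : (0 : ℝ) < G.degree v - 1 := by
  have : (2 : ℝ) ≤ G.degree v := by exact_mod_cast hdeg v
  linarith

theorem degree_pos (hdeg : ∀ v, 2 ≤ G.degree v) (v : V) : (0 : ℝ) < G.degree v := by
  linarith [degree_sub_one_pos hdeg v]

end Degrees

section DartSums

variable {V : Type*} [Fintype V] [DecidableEq V] {G : SimpleGraph V} [DecidableRel G.Adj]
  {M : Type*} [AddCommMonoid M]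

theorem sum_dart_fst (b : V) (F : V → M) :
    ∑ e : G.Dart, (if e.fst = b then F e.snd else 0) = ∑ c ∈ G.neighborFinset b, F c := by
  rw [← Finset.sum_filter]
  symm
  refine Finset.sum_bij (fun c hc => ⟨(b, c), (G.mem_neighborFinset b c).1 hc⟩) ?_ ?_ ?_ ?_
  · simp
  · intro c _ c' _ h
    simpa using congrArg (fun e : G.Dart => e.snd) h
  · intro e he
    obtain rfl := (Finset.mem_filter.1 he).2
    exact ⟨e.snd, (G.mem_neighborFinset _ _).2 e.adj, rfl⟩
  · simp

theorem sum_dart_snd (b : V) (F : V → M) :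
    ∑ e : G.Dart, (if e.snd = b then F e.fst else 0) = ∑ c ∈ G.neighborFinset b, F c := by
  rw [← sum_dart_fst]
  exact Fintype.sum_equiv (Function.Involutive.toPerm _ SimpleGraph.Dart.symm_involutive) _ _
    fun e => rfl

end DartSums

/-! ### The edge chain is doubly stochastic, and only constants are invariant -/

section Algebra

variable {V : Type*} [Fintype V] [DecidableEq V] {G : SimpleGraph V} [DecidableRel G.Adj]

theorem card_dart_eq : (Fintype.card G.Dart : ℝ) = 2 * (G.edgeFinset.card : ℝ) := by
  exact_mod_cast G.dart_card_eq_twice_card_edges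

theorem two_mul_card_edges_pos (hdeg : ∀ v, 2 ≤ G.degree v) (v : V) :
    (0 : ℝ) < 2 * (G.edgeFinset.card : ℝ) := by
  obtain ⟨w, hw⟩ := (G.degree_pos_iff_exists_adj v).1 (by have := hdeg v; omega)
  have : Nonempty G.Dart := ⟨⟨(v, w), hw⟩⟩
  rw [← card_dart_eq]
  exact_mod_cast Fintype.card_pos

theorem sum_neighborFinset_ne (c : ℝ) {a b : V} (h : G.Adj b a) :
    ∑ x ∈ G.neighborFinset b, (if x ≠ a then c else 0) = (G.degree b - 1) * c := by
  have ha : a ∈ G.neighborFinset b := (G.mem_neighborFinset b a).2 h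
  rw [← Finset.sum_filter, Finset.sum_const, Finset.filter_ne', Finset.card_erase_of_mem ha,
    G.card_neighborFinset_eq_degree, nsmul_eq_mul, Nat.cast_sub, Nat.cast_one]
  exact Nat.succ_le_iff.2 ((G.degree_pos_iff_exists_adj b).2 ⟨a, h⟩)

theorem Pnb_nonneg (hdeg : ∀ v, 2 ≤ G.degree v) (e f : G.Dart) : 0 ≤ Pnb G e f := by
  rw [Pnb, Matrix.of_apply]
  split_ifs
  · exact (one_div_pos.2 (degree_sub_one_pos hdeg _)).le
  · exact le_rfl

theorem sum_Pnb_row (hdeg : ∀ v, 2 ≤ G.degree v) (e : G.Dart) : ∑ f, Pnb G e f = 1 := by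
  have h : ∀ f : G.Dart, Pnb G e f = if f.fst = e.snd then
      (if f.snd ≠ e.fst then 1 / ((G.degree e.snd : ℝ) - 1) else 0) else 0 := fun f => by
    rw [Pnb, Matrix.of_apply, ite_and]
    simp only [eq_comm]
  simp_rw [h]
  rw [sum_dart_fst e.snd fun c => if c ≠ e.fst then 1 / ((G.degree e.snd : ℝ) - 1) else 0,
    sum_neighborFinset_ne _ e.adj.symm, mul_one_div_cancel (degree_sub_one_pos hdeg _).ne']

theorem sum_Pnb_col (hdeg : ∀ v, 2 ≤ G.degree v) (f : G.Dart) : ∑ e, Pnb G e f = 1 := by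
  have h : ∀ e : G.Dart, Pnb G e f = if e.snd = f.fst then
      (if e.fst ≠ f.snd then 1 / ((G.degree f.fst : ℝ) - 1) else 0) else 0 := fun e => by
    rw [Pnb, Matrix.of_apply, ite_and]
    split_ifs with h1 h2 h3 h3 <;> simp_all
    exact congrArg (fun v => G.degree v) h1
  simp_rw [h]
  rw [sum_dart_snd f.fst fun c => if c ≠ f.snd then 1 / ((G.degree f.fst : ℝ) - 1) else 0,
    sum_neighborFinset_ne _ f.adj, mul_one_div_cancel (degree_sub_one_pos hdeg _).ne']

/-- A function on directed edges that does not change along non-backtracking steps is constant,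
provided the graph is connected and has a vertex of degree at least three. -/
theorem eq_of_invariant_step {α : Type*} (hconn : G.Connected) (hdeg : ∀ v, 2 ≤ G.degree v)
    (hcycle : ¬ G.IsRegularOfDegree 2) {v : G.Dart → α}
    (hv : ∀ e f : G.Dart, e.snd = f.fst → f.snd ≠ e.fst → v e = v f) (e f : G.Dart) :
    v e = v f := by
  obtain ⟨x, hx⟩ : ∃ x, 3 ≤ G.degree x := by
    by_contra! h
    exact hcycle fun x => le_antisymm (Nat.lt_succ_iff.1 (h x)) (hdeg x)
  -- Degree three at `x` lets a walker enter `x` from a vertex that leaves any two chosen exits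
  -- admissible, so all edges out of `x` share one value.
  have avoid_two : ∀ a b : V, ∃ y, G.Adj x y ∧ y ≠ a ∧ y ≠ b := fun a b => by
    have hlt : ({a, b} : Finset V).card < (G.neighborFinset x).card := by
      rw [G.card_neighborFinset_eq_degree]
      exact lt_of_le_of_lt Finset.card_le_two hx
    obtain ⟨y, hy, hy'⟩ := Finset.exists_mem_notMem_of_card_lt_card hlt
    simp only [Finset.mem_insert, Finset.mem_singleton, not_or] at hy'
    exact ⟨y, (G.mem_neighborFinset x y).1 hy, hy'⟩
  obtain ⟨y₀, hy₀, -, -⟩ := avoid_two x x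
  set c := v ⟨(x, y₀), hy₀⟩
  have hout : ∀ g : G.Dart, g.fst = x → v g = c := fun g hg => by
    obtain ⟨y, hy, h1, h2⟩ := avoid_two g.snd y₀
    rw [← hv ⟨(y, x), hy.symm⟩ g hg.symm h1.symm]
    exact hv ⟨(y, x), hy.symm⟩ ⟨(x, y₀), hy₀⟩ rfl h2.symm
  have hin : ∀ g : G.Dart, g.snd = x → v g = c := fun g hg => by
    obtain ⟨y, hy, h1, -⟩ := avoid_two g.fst x
    rw [hv g ⟨(x, y), hy⟩ hg h1]
    exact hout _ rfl
  -- The value spreads along a path to `x`: an edge at `y` either joins `y` to the next vertex `z'`,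
  -- or forms a non-backtracking pair with the edge between `y` and `z'`.
  have hall : ∀ z, ∀ g : G.Dart, (g.fst = z → v g = c) ∧ (g.snd = z → v g = c) := fun z => by
    obtain ⟨p⟩ := hconn.preconnected z x
    induction p with
    | nil => exact fun g => ⟨hout g, hin g⟩
    | @cons y z' w h p ih =>
      have ih := ih hx avoid_two hy₀ hout hin
      intro g
      refine ⟨fun hg => ?_, fun hg => ?_⟩
      · by_cases hz : g.snd = z'
        · exact (ih g).2 hz
        · rw [← hv ⟨(z', y), h.symm⟩ g hg.symm hz]
          exact (ih _).1 rfl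
      · by_cases hz : g.fst = z'
        · exact (ih g).1 hz
        · rw [hv g ⟨(y, z'), h⟩ hg (Ne.symm hz)]
          exact (ih _).2 rfl
  rw [(hall _ e).1 rfl, (hall _ f).1 rfl]

/-- Expanding the Dirichlet form `∑ P e f (v e - v f)²` with `P v = v` and unit row and column sums
gives 0. Thus `v` is unchanged along every step of positive probability. -/
theorem eq_of_Pnb_mulVec_eq_self (hconn : G.Connected) (hdeg : ∀ v, 2 ≤ G.degree v)
    (hcycle : ¬ G.IsRegularOfDegree 2) {v : G.Dart → ℝ} (hv : (Pnb G).mulVec v = v)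
    (e f : G.Dart) : v e = v f := by
  have hv' : ∀ e, ∑ f, Pnb G e f * v f = v e := fun e => congrFun hv e
  have h0 : ∑ e, ∑ f, Pnb G e f * (v e - v f) ^ 2 = 0 := by
    have h1 : ∀ e, ∑ f, Pnb G e f * (v e - v f) ^ 2 =
        ∑ f, Pnb G e f * v f ^ 2 - v e ^ 2 := fun e => by
      calc ∑ f, Pnb G e f * (v e - v f) ^ 2
          = ∑ f, (Pnb G e f * v f ^ 2 - 2 * v e * (Pnb G e f * v f) + v e ^ 2 * Pnb G e f) :=
            Finset.sum_congr rfl fun f _ => by ring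
        _ = _ := by
            rw [Finset.sum_add_distrib, Finset.sum_sub_distrib, ← Finset.mul_sum,
              ← Finset.mul_sum, hv', sum_Pnb_row hdeg]
            ring
    simp_rw [h1]
    rw [Finset.sum_sub_distrib, Finset.sum_comm]
    simp_rw [← Finset.sum_mul, sum_Pnb_col hdeg, one_mul, sub_self]
  refine eq_of_invariant_step hconn hdeg hcycle (v := v) (fun e f h h' => ?_) e f
  have hnn : ∀ e f, 0 ≤ Pnb G e f * (v e - v f) ^ 2 := fun e f =>
    mul_nonneg (Pnb_nonneg hdeg e f) (sq_nonneg _)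
  have h2 := (Finset.sum_eq_zero_iff_of_nonneg fun e _ =>
    Finset.sum_nonneg fun f _ => hnn e f).1 h0 e (Finset.mem_univ e)
  have h3 := (Finset.sum_eq_zero_iff_of_nonneg fun f _ => hnn e f).1 h2 f (Finset.mem_univ f)
  have hP : Pnb G e f ≠ 0 := by
    rw [Pnb, Matrix.of_apply, if_pos ⟨h, h'⟩]
    exact (one_div_pos.2 (degree_sub_one_pos hdeg _)).ne'
  exact sub_eq_zero.1 (pow_eq_zero_iff two_ne_zero |>.1 ((mul_eq_zero.1 h3).resolve_left hP))

/-! ### The fundamental matrix on directed edges -/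

theorem Pnb_mulVec_one (hdeg : ∀ v, 2 ≤ G.degree v) : (Pnb G).mulVec 1 = 1 := by
  ext e
  simpa [Matrix.mulVec, dotProduct] using sum_Pnb_row hdeg e

theorem one_vecMul_Pnb (hdeg : ∀ v, 2 ≤ G.degree v) : Matrix.vecMul 1 (Pnb G) = 1 := by
  ext f
  simpa [Matrix.vecMul, dotProduct] using sum_Pnb_col hdeg f

theorem We_mulVec (v : G.Dart → ℝ) :
    (We G).mulVec v = fun _ => (∑ e, v e) / (2 * (G.edgeFinset.card : ℝ)) := by
  ext e
  simp only [We, statE, Matrix.mulVec, Matrix.vecMulVec_apply, dotProduct, one_mul,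
    ← Finset.mul_sum]
  ring

theorem We_mulVec_one (hdeg : ∀ v, 2 ≤ G.degree v) : (We G).mulVec 1 = 1 := by
  rw [We_mulVec]
  ext e
  simp only [Pi.one_apply, Finset.sum_const, Finset.card_univ, nsmul_eq_mul, mul_one, card_dart_eq]
  exact div_self (two_mul_card_edges_pos hdeg e.fst).ne'

theorem one_vecMul_We (hdeg : ∀ v, 2 ≤ G.degree v) : Matrix.vecMul 1 (We G) = 1 := by
  ext e
  simp only [We, statE, Matrix.vecMul, Matrix.vecMulVec_apply, dotProduct, one_mul, Pi.one_apply,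
    Finset.sum_const, Finset.card_univ, nsmul_eq_mul, card_dart_eq]
  exact mul_one_div_cancel (two_mul_card_edges_pos hdeg e.fst).ne'

theorem one_vecMul_fundamental (hdeg : ∀ v, 2 ≤ G.degree v) :
    Matrix.vecMul 1 (1 - Pnb G + We G) = 1 := by
  rw [Matrix.vecMul_add, Matrix.vecMul_sub, Matrix.vecMul_one, one_vecMul_Pnb hdeg,
    one_vecMul_We hdeg, sub_self, zero_add]

theorem fundamental_mulVec_one (hdeg : ∀ v, 2 ≤ G.degree v) :
    (1 - Pnb G + We G).mulVec 1 = 1 := by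
  rw [Matrix.add_mulVec, Matrix.sub_mulVec, Matrix.one_mulVec, Pnb_mulVec_one hdeg,
    We_mulVec_one hdeg, sub_self, zero_add]

theorem sum_fundamental_mulVec (hdeg : ∀ v, 2 ≤ G.degree v) (v : G.Dart → ℝ) :
    ∑ e, (1 - Pnb G + We G).mulVec v e = ∑ e, v e := by
  have := Matrix.dotProduct_mulVec 1 (1 - Pnb G + We G) v
  rw [one_vecMul_fundamental hdeg] at this
  simpa [dotProduct] using this

/-- A kernel vector has sum zero because the column sums are 1; then `W_e` annihilates it, so it is
fixed by `P`, hence constant, hence zero. -/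
theorem isUnit_fundamental (hconn : G.Connected) (hdeg : ∀ v, 2 ≤ G.degree v)
    (hcycle : ¬ G.IsRegularOfDegree 2) : IsUnit (1 - Pnb G + We G) := by
  rw [← Matrix.mulVec_injective_iff_isUnit]
  refine (injective_iff_map_eq_zero (Matrix.mulVecLin (1 - Pnb G + We G))).2 fun v hv => ?_
  rw [Matrix.mulVecLin_apply] at hv
  have hsum : ∑ e, v e = 0 := by
    rw [← sum_fundamental_mulVec hdeg, hv]
    simp
  have hP : (Pnb G).mulVec v = v := by
    rw [Matrix.add_mulVec, Matrix.sub_mulVec, Matrix.one_mulVec, We_mulVec, hsum, zero_div] at hv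
    ext e
    have := congrFun hv e
    simp only [Pi.add_apply, Pi.sub_apply, Pi.zero_apply, add_zero] at this
    linarith
  ext e
  have hc := eq_of_Pnb_mulVec_eq_self hconn hdeg hcycle hP
  rw [Finset.sum_congr rfl fun f _ => hc f e, Finset.sum_const, Finset.card_univ, nsmul_eq_mul,
    card_dart_eq] at hsum
  exact (mul_eq_zero.1 hsum).resolve_left (two_mul_card_edges_pos hdeg e.fst).ne'

theorem Ze_mul_fundamental (hU : IsUnit (1 - Pnb G + We G)) :
    Ze G * (1 - Pnb G + We G) = 1 :=
  Matrix.nonsing_inv_mul _ ((Matrix.isUnit_iff_isUnit_det _).1 hU)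

theorem fundamental_mul_Ze (hU : IsUnit (1 - Pnb G + We G)) :
    (1 - Pnb G + We G) * Ze G = 1 :=
  Matrix.mul_nonsing_inv _ ((Matrix.isUnit_iff_isUnit_det _).1 hU)

theorem Ze_mulVec_one (hdeg : ∀ v, 2 ≤ G.degree v) (hU : IsUnit (1 - Pnb G + We G)) :
    (Ze G).mulVec 1 = 1 := by
  conv_lhs => rw [← fundamental_mulVec_one hdeg]
  rw [Matrix.mulVec_mulVec, Ze_mul_fundamental hU, Matrix.one_mulVec]

theorem one_vecMul_Ze (hdeg : ∀ v, 2 ≤ G.degree v) (hU : IsUnit (1 - Pnb G + We G)) :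
    Matrix.vecMul 1 (Ze G) = 1 := by
  conv_lhs => rw [← one_vecMul_fundamental hdeg]
  rw [Matrix.vecMul_vecMul, fundamental_mul_Ze hU, Matrix.vecMul_one]

theorem sum_Ze_mulVec (hdeg : ∀ v, 2 ≤ G.degree v) (hU : IsUnit (1 - Pnb G + We G))
    (v : G.Dart → ℝ) : ∑ e, (Ze G).mulVec v e = ∑ e, v e := by
  have := Matrix.dotProduct_mulVec 1 (Ze G) v
  rw [one_vecMul_Ze hdeg hU] at this
  simpa [dotProduct] using this

theorem Ze_mul_We (hdeg : ∀ v, 2 ≤ G.degree v) (hU : IsUnit (1 - Pnb G + We G)) :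
    Ze G * We G = We G := by
  rw [We, Matrix.mul_vecMulVec]
  congr 1
  exact Ze_mulVec_one hdeg hU

/-! ### Projection from directed edges to vertices -/

theorem Pnb_mul_transpose_T (hdeg : ∀ v, 2 ≤ G.degree v) : Pnb G * (T G).transpose = S G := by
  ext e x
  rw [Matrix.mul_apply]
  simp only [T, S, Matrix.transpose_apply, Matrix.of_apply]
  split_ifs with h
  · refine (Finset.sum_congr rfl fun f _ => ?_).trans (sum_Pnb_row hdeg e)
    rw [Pnb, Matrix.of_apply]
    split_ifs with h1 h2 <;> simp_all
  · refine Finset.sum_eq_zero fun f _ => ?_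
    rw [Pnb, Matrix.of_apply]
    split_ifs with h1 h2 <;> simp_all

theorem sum_dart_S (x : V) : ∑ e, S G e x = G.degree x := by
  have := sum_dart_snd (G := G) x fun _ => (1 : ℝ)
  simpa [S] using this

theorem Dinv_mul_T_mulVec (v : G.Dart → ℝ) (i : V) :
    (Dinv G * T G).mulVec v i = (G.degree i : ℝ)⁻¹ * ∑ e : G.Dart, if e.fst = i then v e else 0 := by
  rw [← Matrix.mulVec_mulVec, Dinv, Matrix.mulVec_diagonal]
  simp [T, Matrix.mulVec, dotProduct]

theorem sum_dart_ite_fst (i : V) (c : ℝ) :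
    (∑ e : G.Dart, if e.fst = i then c else 0) = G.degree i * c := by
  rw [sum_dart_fst i fun _ => c]
  simp

theorem Dinv_mul_T_mulVec_one (hdeg : ∀ v, 2 ≤ G.degree v) : (Dinv G * T G).mulVec 1 = 1 := by
  ext i
  rw [Dinv_mul_T_mulVec]
  simp only [Pi.one_apply]
  rw [sum_dart_ite_fst, mul_one, inv_mul_cancel₀ (degree_pos hdeg i).ne']

theorem sum_statV_mul_Dinv_mul_T_mulVec (hdeg : ∀ v, 2 ≤ G.degree v) (v : G.Dart → ℝ) :
    ∑ i, statV G i * (Dinv G * T G).mulVec v i =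
      (∑ e, v e) / (2 * (G.edgeFinset.card : ℝ)) := by
  have h : ∀ i, statV G i * (Dinv G * T G).mulVec v i =
      (∑ e : G.Dart, if e.fst = i then v e else 0) / (2 * (G.edgeFinset.card : ℝ)) := fun i => by
    have := (degree_pos hdeg i).ne'
    rw [Dinv_mul_T_mulVec, statV]
    field_simp
  simp_rw [h]
  rw [← Finset.sum_div, Finset.sum_comm]
  simp

theorem sum_statV [Nonempty V] (hdeg : ∀ v, 2 ≤ G.degree v) : ∑ i, statV G i = 1 := by
  have h : (∑ i, (G.degree i : ℝ)) = 2 * (G.edgeFinset.card : ℝ) := by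
    exact_mod_cast G.sum_degrees_eq_twice_card_edges
  simp only [statV]
  rw [← Finset.sum_div, h]
  exact div_self (two_mul_card_edges_pos hdeg (Classical.arbitrary V)).ne'

theorem Dinv_mul_T_mul_transpose (hdeg : ∀ v, 2 ≤ G.degree v) :
    Dinv G * T G * (T G).transpose = 1 := by
  ext i j
  change (Dinv G * T G).mulVec (fun e => T G j e) i = _
  rw [Dinv_mul_T_mulVec, Matrix.one_apply]
  simp only [T, Matrix.of_apply]
  split_ifs with h
  · subst h
    have : ∀ e : G.Dart, (if e.fst = i then (if e.fst = i then (1 : ℝ) else 0) else 0) =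
        if e.fst = i then 1 else 0 := fun e => by split_ifs <;> rfl
    simp_rw [this]
    rw [sum_dart_ite_fst, mul_one, inv_mul_cancel₀ (degree_pos hdeg i).ne']
  · rw [Finset.sum_eq_zero, mul_zero]
    intro e _
    split_ifs with h1 h2
    · exact absurd (h1.symm.trans h2) h
    · rfl
    · rfl

theorem Dinv_mul_T_mul_We_mul_transpose (hdeg : ∀ v, 2 ≤ G.degree v) :
    Dinv G * T G * We G * (T G).transpose = Wv G := by
  rw [We, Matrix.mul_vecMulVec, Matrix.vecMulVec_mul, Wv]
  congr 1
  · exact Dinv_mul_T_mulVec_one hdeg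
  · ext x
    have h := sum_dart_ite_fst (G := G) x (1 / (2 * (G.edgeFinset.card : ℝ)))
    simp only [Matrix.vecMul, dotProduct, statE, T, Matrix.transpose_apply, Matrix.of_apply,
      mul_ite, mul_one, mul_zero, h, statV]
    ring

/-- The vertex fundamental matrix in terms of out-edges only. -/
theorem Zv_eq (hdeg : ∀ v, 2 ≤ G.degree v) (hU : IsUnit (1 - Pnb G + We G)) :
    Zv G = Dinv G * T G * Ze G * (T G).transpose := by
  -- With `S = P Tᵀ`, this splits `D⁻¹ T Z_e S` into the desired term plus `W_v - I`, which the
  -- definition of `Zv` cancels.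
  have h : Ze G * Pnb G = Ze G + We G - 1 := by
    have := Ze_mul_fundamental hU
    rw [mul_add, mul_sub, mul_one, Ze_mul_We hdeg hU] at this
    rw [← this]
    abel
  rw [Zv, ← Pnb_mul_transpose_T hdeg, Matrix.mul_assoc (Dinv G * T G) (Ze G),
    ← Matrix.mul_assoc (Ze G), h, ← Matrix.mul_assoc (Dinv G * T G)]
  rw [Matrix.mul_sub, Matrix.mul_add, Matrix.mul_one, Matrix.sub_mul, Matrix.add_mul,
    Dinv_mul_T_mul_transpose hdeg, Dinv_mul_T_mul_We_mul_transpose hdeg]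
  abel

theorem Zv_apply (i j : V) :
    Zv G i j = (if i = j then 1 else 0) +
      (Dinv G * T G).mulVec ((Ze G).mulVec fun e => S G e j) i - statV G j := by
  rw [Zv, Matrix.sub_apply, Matrix.add_apply, Matrix.one_apply, Wv, Matrix.vecMulVec_apply, one_mul,
    Matrix.mulVec_mulVec]
  rfl

/-- Weighting out-edge averages by `π` gives the uniform average over edges, and `Z_e` preserves
sums; the contributions of `I` and `W_v` cancel. -/
theorem sum_statV_mul_Zv (hdeg : ∀ v, 2 ≤ G.degree v) (hU : IsUnit (1 - Pnb G + We G)) (j : V) :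
    ∑ i, statV G i * Zv G i j = statV G j := by
  have : Nonempty V := ⟨j⟩
  simp_rw [Zv_apply, mul_sub, mul_add]
  rw [Finset.sum_sub_distrib, Finset.sum_add_distrib, sum_statV_mul_Dinv_mul_T_mulVec hdeg,
    sum_Ze_mulVec hdeg hU, sum_dart_S, ← Finset.sum_mul, sum_statV hdeg]
  simp [statV]

/-- There is a function on directed edges that solves the hitting time equations for `j` away from
the edges that end at `j`. -/
theorem exists_solution (hdeg : ∀ v, 2 ≤ G.degree v)
    (hU : IsUnit (1 - Pnb G + We G)) (j : V) :
    ∃ u : G.Dart → ℝ, (∀ e, 0 ≤ u e) ∧ ∀ e, e.snd ≠ j → u e = 1 + ∑ f, Pnb G e f * u f := by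
  have hm := two_mul_card_edges_pos hdeg j
  have hd := degree_pos hdeg j
  -- This `c` makes the sum of `w` vanish, so `v = Z_e w` solves `v = w + P v`, and `w` is 1 off the
  -- edges into `j`.
  set c : ℝ := 2 * (G.edgeFinset.card : ℝ) / G.degree j
  set w : G.Dart → ℝ := fun e => 1 - c * S G e j with hw
  set v := (Ze G).mulVec w
  have hsum : ∑ e, v e = 0 := by
    rw [sum_Ze_mulVec hdeg hU]
    simp only [hw]
    rw [Finset.sum_sub_distrib, ← Finset.mul_sum, sum_dart_S]
    simp only [Finset.sum_const, Finset.card_univ, nsmul_eq_mul, mul_one, card_dart_eq, c]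
    field_simp
    ring
  have hv : ∀ e, v e = w e + ∑ f, Pnb G e f * v f := fun e => by
    have h : (1 - Pnb G + We G).mulVec v = w := by
      rw [Matrix.mulVec_mulVec, fundamental_mul_Ze hU, Matrix.one_mulVec]
    rw [Matrix.add_mulVec, Matrix.sub_mulVec, Matrix.one_mulVec, We_mulVec, hsum, zero_div] at h
    have := congrFun h e
    simp only [Pi.add_apply, Pi.sub_apply, add_zero, Matrix.mulVec, dotProduct] at this
    linarith
  -- Adding a constant secures nonnegativity and preserves the equation, as `P` fixes constants.
  refine ⟨fun e => v e + ∑ f, |v f|, fun e => ?_, fun e he => ?_⟩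
  · have := Finset.single_le_sum (f := fun f => |v f|) (fun f _ => abs_nonneg (v f))
      (Finset.mem_univ e)
    linarith [neg_abs_le (v e)]
  · simp_rw [mul_add]
    rw [Finset.sum_add_distrib, ← Finset.sum_mul, sum_Pnb_row hdeg, hv e]
    simp [hw, S, he]
    ring

/-- The hitting time equations, when the mean return time to `j` does not depend on the first
step, determine the hitting times from the vertices in terms of the fundamental matrix. -/
theorem exists_const_sub_Zv (hdeg : ∀ v, 2 ≤ G.degree v) (hU : IsUnit (1 - Pnb G + We G)) (j : V)
    {H : G.Dart → ℝ} {r : ℝ} (hH : ∀ e, H e = 1 - r * S G e j + ∑ f, Pnb G e f * H f) :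
    r * statV G j = 1 ∧ ∃ c, ∀ i,
      1 + (Dinv G * T G).mulVec H i - (if i = j then r else 0) = c - Zv G i j * r := by
  have hm := two_mul_card_edges_pos hdeg j
  have hr : r * statV G j = 1 := by
    -- Summing over all edges cancels `H` and leaves Kac's formula `r deg j = 2m`.
    have h := Finset.sum_congr (rfl : (Finset.univ : Finset G.Dart) = _) fun e _ => hH e
    rw [Finset.sum_add_distrib, Finset.sum_comm (f := fun e f => Pnb G e f * H f)] at h
    simp_rw [← Finset.sum_mul, sum_Pnb_col hdeg, one_mul] at h
    rw [Finset.sum_sub_distrib, ← Finset.mul_sum, sum_dart_S] at h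
    simp only [Finset.sum_const, Finset.card_univ, nsmul_eq_mul, mul_one, card_dart_eq] at h
    rw [statV, ← mul_div_assoc, div_eq_one_iff_eq hm.ne']
    linarith
  refine ⟨hr, ?_⟩
  set a := (∑ e, H e) / (2 * (G.edgeFinset.card : ℝ))
  have h1 : (1 - Pnb G + We G).mulVec H = (1 + a) • 1 - r • fun e => S G e j := by
    ext e
    rw [Matrix.add_mulVec, Matrix.sub_mulVec, Matrix.one_mulVec, We_mulVec]
    simp only [Pi.add_apply, Pi.sub_apply, Pi.smul_apply, Pi.one_apply, smul_eq_mul,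
      Matrix.mulVec, dotProduct]
    linarith [hH e]
  have h2 : H = (1 + a) • 1 - r • (Ze G).mulVec fun e => S G e j := by
    rw [← Matrix.one_mulVec H, ← Ze_mul_fundamental hU, ← Matrix.mulVec_mulVec, h1,
      Matrix.mulVec_sub, Matrix.mulVec_smul, Matrix.mulVec_smul, Ze_mulVec_one hdeg hU]
  refine ⟨1 + a, fun i => ?_⟩
  rw [h2, Matrix.mulVec_sub, Matrix.mulVec_smul, Matrix.mulVec_smul, Dinv_mul_T_mulVec_one hdeg,
    Zv_apply]
  simp only [Pi.sub_apply, Pi.smul_apply, Pi.one_apply, smul_eq_mul]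
  split_ifs <;> linear_combination -hr

end Algebra

/-! ### Finiteness and the linear system for mean hitting times -/

section HittingTimes

variable {V : Type*} [Fintype V] [DecidableEq V] {G : SimpleGraph V} [DecidableRel G.Adj]

theorem sum_erase_eq_sum_Pnb (hdeg : ∀ v, 2 ≤ G.degree v) (e : G.Dart) (g : V → V → ℝ≥0∞) :
    ∑ c ∈ (G.neighborFinset e.snd).erase e.fst,
      (((G.neighborFinset e.snd).erase e.fst).card : ℝ≥0∞)⁻¹ * g e.snd c =
    ∑ f : G.Dart, ENNReal.ofReal (Pnb G e f) * g f.fst f.snd := by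
  have hmem : e.fst ∈ G.neighborFinset e.snd := (G.mem_neighborFinset _ _).2 e.adj.symm
  set k : ℝ≥0∞ := (((G.neighborFinset e.snd).erase e.fst).card : ℝ≥0∞)⁻¹ with hk
  have hk' : ENNReal.ofReal (1 / ((G.degree e.snd : ℝ) - 1)) = k := by
    rw [hk, Finset.card_erase_of_mem hmem, G.card_neighborFinset_eq_degree, one_div,
      ENNReal.ofReal_inv_of_pos (degree_sub_one_pos hdeg _), ← Nat.cast_one,
      ← Nat.cast_sub (le_trans one_le_two (hdeg _)), ENNReal.ofReal_natCast]
  have h : ∀ f : G.Dart, ENNReal.ofReal (Pnb G e f) * g f.fst f.snd =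
      if f.fst = e.snd then (if f.snd ≠ e.fst then k * g e.snd f.snd else 0) else 0 := fun f => by
    rw [Pnb, Matrix.of_apply, ite_and]
    by_cases h1 : e.snd = f.fst
    · rw [if_pos h1, if_pos h1.symm]
      split_ifs
      · rw [hk', h1]
      · simp
    · rw [if_neg h1, if_neg (Ne.symm h1)]
      simp
  simp_rw [h]
  rw [sum_dart_fst e.snd fun c => if c ≠ e.fst then k * g e.snd c else 0, ← Finset.sum_filter,
    Finset.filter_ne']

/-- The series is the least nonnegative solution: its partial sums start at 0 and obey the same
recursion, so induction keeps them below any supersolution. -/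
theorem meanHittingDart_le (j : V) {u : V → V → ℝ≥0∞}
    (hu : ∀ a b, G.Adj a b → b ≠ j → 1 + ∑ c ∈ (G.neighborFinset b).erase a,
      (((G.neighborFinset b).erase a).card : ℝ≥0∞)⁻¹ * u b c ≤ u a b)
    {a b : V} (hab : G.Adj a b) : meanHittingDart G j a b ≤ u a b := by
  have h : ∀ N a b, G.Adj a b → (if b = j then 0 else
      ∑ n ∈ Finset.range N, (killedStep G j)^[n] (fun _ _ => 1) a b) ≤ u a b := by
    intro N
    induction N with
    | zero => simp
    | succ N ih =>
      intro a b hab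
      split_ifs with hb
      · exact bot_le
      · refine le_trans ?_ (hu a b hab hb)
        rw [Finset.sum_range_succ', add_comm]
        refine add_le_add le_rfl ?_
        simp_rw [Function.iterate_succ_apply']
        unfold killedStep
        rw [Finset.sum_comm]
        refine Finset.sum_le_sum fun c hc => ?_
        rw [← Finset.mul_sum]
        refine mul_le_mul' le_rfl (le_trans (le_of_eq ?_)
          (ih b c ((G.mem_neighborFinset b c).1 (Finset.mem_of_mem_erase hc))))
        split_ifs
        · simp
        · rfl
  unfold meanHittingDart
  split_ifs with hb
  · exact bot_le
  · refine ENNReal.tsum_le_of_sum_range_le fun N => ?_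
    simpa [hb] using h N a b hab

theorem meanHittingDart_ne_top (hdeg : ∀ v, 2 ≤ G.degree v) (hU : IsUnit (1 - Pnb G + We G))
    (j : V) (e : G.Dart) : meanHittingDart G j e.fst e.snd ≠ ∞ := by
  obtain ⟨u, hu0, hu⟩ := exists_solution hdeg hU j
  classical
  let U : V → V → ℝ≥0∞ := fun a b => if h : G.Adj a b then ENNReal.ofReal (u ⟨(a, b), h⟩) else 0
  have hUe : ∀ f : G.Dart, U f.fst f.snd = ENNReal.ofReal (u f) := fun f => dif_pos f.adj
  refine ne_top_of_le_ne_top (hUe e ▸ ENNReal.ofReal_ne_top) (meanHittingDart_le j ?_ e.adj)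
  intro a b hab hb
  have h1 := sum_erase_eq_sum_Pnb hdeg ⟨(a, b), hab⟩ U
  dsimp only at h1
  rw [h1]
  change _ ≤ U (⟨(a, b), hab⟩ : G.Dart).fst (⟨(a, b), hab⟩ : G.Dart).snd
  have hP := Pnb_nonneg (G := G) hdeg
  simp_rw [hUe, ← ENNReal.ofReal_mul (hP _ _)]
  rw [← ENNReal.ofReal_sum_of_nonneg fun f _ => mul_nonneg (hP _ f) (hu0 f), ← ENNReal.ofReal_one,
    ← ENNReal.ofReal_add zero_le_one (Finset.sum_nonneg fun f _ => mul_nonneg (hP _ f) (hu0 f)),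
    ← hu ⟨(a, b), hab⟩ hb, ← hUe]

theorem toReal_meanHittingDart_of_ne (hdeg : ∀ v, 2 ≤ G.degree v)
    (hU : IsUnit (1 - Pnb G + We G)) {j : V} {e : G.Dart} (he : e.snd ≠ j) :
    (meanHittingDart G j e.fst e.snd).toReal =
      1 + ∑ f : G.Dart, Pnb G e f * (meanHittingDart G j f.fst f.snd).toReal := by
  have hfin : ∀ f : G.Dart, ENNReal.ofReal (Pnb G e f) * meanHittingDart G j f.fst f.snd ≠ ∞ :=
    fun f => ENNReal.mul_ne_top ENNReal.ofReal_ne_top (meanHittingDart_ne_top hdeg hU j f)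
  rw [meanHittingDart_of_ne G e.fst he, sum_erase_eq_sum_Pnb hdeg e (meanHittingDart G j),
    ENNReal.toReal_add ENNReal.one_ne_top (ENNReal.sum_ne_top.2 fun f _ => hfin f),
    ENNReal.toReal_sum fun f _ => hfin f]
  simp [ENNReal.toReal_mul, ENNReal.toReal_ofReal (Pnb_nonneg hdeg _ _)]

theorem sum_neighborFinset_ne_top (hdeg : ∀ v, 2 ≤ G.degree v)
    (hU : IsUnit (1 - Pnb G + We G)) (i j : V) :
    ∑ b ∈ G.neighborFinset i, (G.degree i : ℝ≥0∞)⁻¹ * (1 + meanHittingDart G j i b) ≠ ∞ := by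
  refine ENNReal.sum_ne_top.2 fun b hb => ENNReal.mul_ne_top ?_ ?_
  · have := hdeg i
    exact ENNReal.inv_ne_top.2 (by exact_mod_cast (by omega : G.degree i ≠ 0))
  · exact ENNReal.add_ne_top.2 ⟨ENNReal.one_ne_top,
      meanHittingDart_ne_top hdeg hU j ⟨(i, b), (G.mem_neighborFinset i b).1 hb⟩⟩

theorem toReal_sum_neighborFinset (hdeg : ∀ v, 2 ≤ G.degree v)
    (hU : IsUnit (1 - Pnb G + We G)) (i j : V) :
    (∑ b ∈ G.neighborFinset i,
      (G.degree i : ℝ≥0∞)⁻¹ * (1 + meanHittingDart G j i b)).toReal =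
    1 + (Dinv G * T G).mulVec
      (fun e : G.Dart => (meanHittingDart G j e.fst e.snd).toReal) i := by
  have hfin := sum_neighborFinset_ne_top hdeg hU i j
  rw [ENNReal.toReal_sum (ENNReal.sum_ne_top.1 hfin), Dinv_mul_T_mulVec]
  have h : ∀ e : G.Dart, (if e.fst = i then (meanHittingDart G j e.fst e.snd).toReal else 0) =
      if e.fst = i then (meanHittingDart G j i e.snd).toReal else 0 := fun e => by
    split_ifs with h
    · rw [h]
    · rfl
  simp_rw [h]
  rw [sum_dart_fst i fun b => (meanHittingDart G j i b).toReal]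
  have hd := (degree_pos hdeg i).ne'
  have h1 : ∀ b ∈ G.neighborFinset i,
      ((G.degree i : ℝ≥0∞)⁻¹ * (1 + meanHittingDart G j i b)).toReal =
        (G.degree i : ℝ)⁻¹ * (1 + (meanHittingDart G j i b).toReal) := fun b hb => by
    rw [ENNReal.toReal_mul, ENNReal.toReal_add ENNReal.one_ne_top
      (meanHittingDart_ne_top hdeg hU j ⟨(i, b), (G.mem_neighborFinset i b).1 hb⟩)]
    simp
  rw [Finset.sum_congr rfl h1, ← Finset.mul_sum, Finset.sum_add_distrib, mul_add]
  congr 1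
  simp [hd]

variable [MeasurableSpace V] [DiscreteMeasurableSpace V]

/-- With locally uniform return times, the mean hitting times of `j` satisfy one linear system on
all directed edges, including those that end at `j`. -/
theorem toReal_meanHittingDart_eq (hdeg : ∀ v, 2 ≤ G.degree v)
    (hU : IsUnit (1 - Pnb G + We G)) (hunif : LocallyUniformReturnTime G) (j : V) (e : G.Dart) :
    (meanHittingDart G j e.fst e.snd).toReal = 1 - (meanReturn G j).toReal * S G e j +
      ∑ f : G.Dart, Pnb G e f * (meanHittingDart G j f.fst f.snd).toReal := by
  by_cases he : e.snd = j
  -- The only use of local uniformity: equal values on the out-edges of `j` all equal their average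
  -- `r_j - 1`. Every continuation of `e` starts at `j`, so the equation reads `0 = 1 - r_j + (r_j -
  -- 1)`.
  · have hret : ∀ f : G.Dart, f.fst = j →
        (meanHittingDart G j f.fst f.snd).toReal = (meanReturn G j).toReal - 1 := fun f hf => by
      subst hf
      rw [meanReturn_eq hdeg, toReal_sum_neighborFinset hdeg hU, Dinv_mul_T_mulVec,
        Finset.sum_congr (g := fun e : G.Dart => if e.fst = f.fst then
          (meanHittingDart G f.fst f.fst f.snd).toReal else 0) rfl, sum_dart_ite_fst, ← mul_assoc,
        inv_mul_cancel₀ (degree_pos hdeg _).ne', one_mul, add_sub_cancel_left]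
      intro e _
      split_ifs with h
      · have h1 := hunif f.fst e.snd f.snd (h ▸ e.adj) f.adj
        rw [meanReturnVia_eq hdeg (h ▸ e.adj), meanReturnVia_eq hdeg f.adj] at h1
        rw [h, (ENNReal.add_right_inj ENNReal.one_ne_top).1 h1]
      · rfl
    have hsum : ∑ f : G.Dart, Pnb G e f * (meanHittingDart G j f.fst f.snd).toReal =
        ∑ f : G.Dart, Pnb G e f * ((meanReturn G j).toReal - 1) := by
      refine Finset.sum_congr rfl fun f _ => ?_
      by_cases hf : f.fst = j
      · rw [hret f hf]
      · rw [Pnb, Matrix.of_apply, if_neg fun h => hf (h.1.symm.trans he), zero_mul, zero_mul]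
    rw [hsum, ← Finset.sum_mul, sum_Pnb_row hdeg, meanHittingDart, if_pos he]
    simp [S, he]
  · rw [toReal_meanHittingDart_of_ne hdeg hU he]
    simp [S, he]

end HittingTimes

end NBWalk

/-! ### The theorem -/

theorem mainTheorem1 {V : Type*} [Fintype V] [DecidableEq V]
    [MeasurableSpace V] [DiscreteMeasurableSpace V]
    (G : SimpleGraph V) [DecidableRel G.Adj]
    (hconn : G.Connected) (hdeg : ∀ v, 2 ≤ G.degree v) (hcycle : ¬ G.IsRegularOfDegree 2)
    (hunif : NBWalk.LocallyUniformReturnTime G) :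
    (∀ i j, NBWalk.meanHitting G i j ≠ ∞) ∧
    (∀ i, NBWalk.meanReturn G i ≠ ∞) ∧
    IsUnit (1 - NBWalk.Pnb G + NBWalk.We G) ∧
    NBWalk.Zv G =
      NBWalk.Dinv G * NBWalk.T G * NBWalk.Ze G * (NBWalk.T G).transpose ∧
    NBWalk.hittingMatrix G =
      Matrix.of (fun _ _ => (1 : ℝ)) - NBWalk.Zv G * NBWalk.returnMatrix G
        + NBWalk.Wv G * NBWalk.hittingMatrix G ∧
    ∀ i j, NBWalk.hittingMatrix G i j =
      (NBWalk.Zv G j j - NBWalk.Zv G i j) / NBWalk.statV G j := by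
  have hU := NBWalk.isUnit_fundamental hconn hdeg hcycle
  have : Nonempty V := hconn.nonempty
  have key : ∀ j, (NBWalk.meanReturn G j).toReal * NBWalk.statV G j = 1 ∧ ∃ c, ∀ i,
      NBWalk.hittingMatrix G i j = c - NBWalk.Zv G i j * (NBWalk.meanReturn G j).toReal := by
    intro j
    obtain ⟨hr, c, hc⟩ := NBWalk.exists_const_sub_Zv hdeg hU j
      (NBWalk.toReal_meanHittingDart_eq hdeg hU hunif j)
    refine ⟨hr, c, fun i => ?_⟩
    rw [← hc i, ← NBWalk.toReal_sum_neighborFinset hdeg hU, NBWalk.hittingMatrix, Matrix.of_apply]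
    -- On the diagonal, one plus the out-edge average is the mean return time, so subtracting `r_j`
    -- leaves `m_jj = 0`.
    by_cases hij : i = j
    · subst hij
      rw [if_pos rfl, if_pos rfl, ← NBWalk.meanReturn_eq hdeg, sub_self]
    · rw [if_neg (Ne.symm hij), if_neg hij, NBWalk.meanHitting_eq hdeg hij, sub_zero]
  refine ⟨fun i j => ?_, fun i => ?_, hU, NBWalk.Zv_eq hdeg hU, ?_, fun i j => ?_⟩
  · by_cases hij : i = j
    · rw [hij, NBWalk.meanHitting_self]
      exact ENNReal.zero_ne_top
    · rw [NBWalk.meanHitting_eq hdeg hij]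
      exact NBWalk.sum_neighborFinset_ne_top hdeg hU i j
  · rw [NBWalk.meanReturn_eq hdeg]
    exact NBWalk.sum_neighborFinset_ne_top hdeg hU i i
  · ext i j
    obtain ⟨hr, c, hc⟩ := key j
    -- The `π`-average of column `j` is `c - π_j r_j`, and `π_j r_j = 1`.
    have h1 : (NBWalk.Wv G * NBWalk.hittingMatrix G) i j = c - 1 := by
      simp only [Matrix.mul_apply, NBWalk.Wv, Matrix.vecMulVec_apply, one_mul, hc, mul_sub,
        ← mul_assoc]
      rw [Finset.sum_sub_distrib, ← Finset.sum_mul, ← Finset.sum_mul, NBWalk.sum_statV hdeg,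
        NBWalk.sum_statV_mul_Zv hdeg hU, one_mul, mul_comm, hr]
    rw [Matrix.add_apply, Matrix.sub_apply, h1, NBWalk.returnMatrix, Matrix.mul_diagonal, hc,
      Matrix.of_apply]
    ring
  · obtain ⟨hr, c, hc⟩ := key j
    have hjj : NBWalk.hittingMatrix G j j = 0 := by simp [NBWalk.hittingMatrix]
    rw [eq_div_iff (right_ne_zero_of_mul_eq_one hr), hc i]
    rw [hc j] at hjj
    linear_combination NBWalk.statV G j * hjj + (NBWalk.Zv G j j - NBWalk.Zv G i j) * hr
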